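/- Let $k$ be a field. A $k$-group is an affine group scheme $G$ over $k$, with commutative Hopf algebra $k[G]$. For a $k$-group $G$ let $G\to G^{\mathrm{et}}$ be its maximal pro-étale quotient, i.e. $k[G^{\mathrm{et}}]\subseteq k[G]$ is the union of all étale Hopf subalgebras, and let $G\to\pi_0(G)$ be the $k$-group of connected components, i.e. $k[\pi_0(G)]\subseteq k[G]$ is the largest separable subalgebra (the union of all étale subalgebras); these two quotients of $G$ coincide. For morphisms $\alpha_1\colon H\to G_1$ and $\alpha_2\colon H\to G_2$ of $k$-groups let $G_1*_HG_2$ denote the free product with amalgamation, i.e. the pushout in the category of $k$-groups. Proposition. For all morphisms $\alpha_1\colon H\to G_1$ and $\alpha_2\colon H\to G_2$ of $k$-groups, one has $G_1^{\mathrm{et}}*_HG_2^{\mathrm{et}}=G_1^{\mathrm{et}}*_{H^{\mathrm{et}}}G_2^{\mathrm{et}}$, and the canonical morphism $$G_1*_HG_2\longrightarrow G_1^{\mathrm{et}}*_HG_2^{\mathrm{et}}=G_1^{\mathrm{et}}*_{H^{\mathrm{et}}}G_2^{\mathrm{et}}$$ induces an isomorphism $$(G_1*_HG_2)^{\mathrm{et}}\xrightarrow{\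 \sim\ }(G_1^{\mathrm{et}}*_{H^{\mathrm{et}}}G_2^{\mathrm{et}})^{\mathrm{et}}.$$ Equivalently, the canonical morphism $G_1*_HG_2\to\pi_0(G_1)*_{\pi_0(H)}\pi_0(G_2)$ induces an isomorphism $$\pi_0(G_1*_HG_2)\xrightarrow{\ \sim\ }\pi_0\bigl(\pi_0(G_1)*_{\pi_0(H)}\pi_0(G_2)\bigr).$$ Corollary. If $G_1$ and $G_2$ are connected $k$-groups (and $H$ is arbitrary), then $G_1*_HG_2$ is connected. -/

import Mathlib

open CategoryTheory Opposite
open scoped TensorProduct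

universe u

section HopfSubalgebras

variable (k : Type u) [Field k] (A : Type u) [CommRing A] [HopfAlgebra k A]

/-- A `k`-subalgebra `S` of a commutative Hopf algebra `A` is a Hopf subalgebra if the
comultiplication maps `S` into (the image in `A ⊗ A` of) `S ⊗ S` and the antipode maps `S` into
`S`. -/
structure IsHopfSubalgebra {k A : Type u} [Field k] [CommRing A] [HopfAlgebra k A]
    (S : Subalgebra k A) : Prop where
  comul_mem : ∀ a ∈ S,
    Bialgebra.comulAlgHom k A a ∈ (Algebra.TensorProduct.map S.val S.val).range
  antipode_mem : ∀ a ∈ S, HopfAlgebra.antipode k a ∈ S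

/-- The subalgebra generated by all étale Hopf subalgebras of `A` (over a field, étale algebras
are finite dimensional). As the subalgebra generated by two étale Hopf subalgebras is again one,
this is the directed union of the étale Hopf subalgebras. -/
def etaleHopfPart : Subalgebra k A :=
  sSup {S | IsHopfSubalgebra S ∧ Algebra.Etale k S}

/-- The largest separable subalgebra: the subalgebra generated by all étale `k`-subalgebras. -/
def separablePart (k A : Type u) [Field k] [CommRing A] [Algebra k A] : Subalgebra k A :=
  sSup {S | Algebra.Etale k S}

variable {k A}

theorem map_val_mono {S T : Subalgebra k A} (h : S ≤ T) :
    (Algebra.TensorProduct.map S.val S.val).range ≤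
      (Algebra.TensorProduct.map T.val T.val).range := by
  have : Algebra.TensorProduct.map S.val S.val = (Algebra.TensorProduct.map T.val T.val).comp
      (Algebra.TensorProduct.map (Subalgebra.inclusion h) (Subalgebra.inclusion h)) := by
    ext <;> rfl
  rw [this]
  exact AlgHom.range_comp_le_range _ _

theorem isHopfSubalgebra_etaleHopfPart : IsHopfSubalgebra (etaleHopfPart k A) where
  comul_mem := by
    suffices etaleHopfPart k A ≤ (Algebra.TensorProduct.map (etaleHopfPart k A).val
        (etaleHopfPart k A).val).range.comap (Bialgebra.comulAlgHom k A) from this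
    refine sSup_le fun S hS a ha ↦ ?_
    exact map_val_mono (le_sSup hS) (hS.1.comul_mem a ha)
  antipode_mem := by
    suffices etaleHopfPart k A ≤ (etaleHopfPart k A).comap (HopfAlgebra.antipodeAlgHom k A) from this
    exact sSup_le fun S hS a ha ↦ le_sSup (a := S) hS (hS.1.antipode_mem a ha)

theorem map_val_injective (S : Subalgebra k A) :
    Function.Injective (Algebra.TensorProduct.map S.val S.val) :=
  TensorProduct.map_injective_of_flat_flat S.val.toLinearMap S.val.toLinearMap
    Subtype.val_injective Subtype.val_injective

namespace IsHopfSubalgebra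

variable {S : Subalgebra k A} (hS : IsHopfSubalgebra S)

/-- The restriction of the comultiplication to a Hopf subalgebra. -/
noncomputable def comul : S →ₐ[k] S ⊗[k] S :=
  (AlgEquiv.ofInjective _ (map_val_injective S)).symm.toAlgHom.comp
    (((Bialgebra.comulAlgHom k A).comp S.val).codRestrict _ fun a ↦ hS.comul_mem a a.2)

theorem map_comp_comul : (Algebra.TensorProduct.map S.val S.val).comp hS.comul =
    (Bialgebra.comulAlgHom k A).comp S.val := by
  ext a
  exact congrArg Subtype.val ((AlgEquiv.ofInjective _ (map_val_injective S)).apply_symm_apply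
    ⟨_, hS.comul_mem a a.2⟩)

/-- The restriction of the antipode to a Hopf subalgebra. -/
noncomputable def antipode : S →ₐ[k] S :=
  ((HopfAlgebra.antipodeAlgHom k A).comp S.val).codRestrict _ fun a ↦ hS.antipode_mem a a.2

theorem comul_coassoc :
    (Algebra.TensorProduct.assoc k k k S S S).toAlgHom.comp
      ((Algebra.TensorProduct.map hS.comul (.id k S)).comp hS.comul) =
      (Algebra.TensorProduct.map (.id k S) hS.comul).comp hS.comul := by
  have inj : Function.Injective
      (Algebra.TensorProduct.map S.val (Algebra.TensorProduct.map S.val S.val)) :=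
    TensorProduct.map_injective_of_flat_flat S.val.toLinearMap
      (Algebra.TensorProduct.map S.val S.val).toLinearMap
      Subtype.val_injective (map_val_injective S)
  have e1 : (Algebra.TensorProduct.map S.val (Algebra.TensorProduct.map S.val S.val)).comp
      (Algebra.TensorProduct.assoc k k k S S S).toAlgHom =
      (Algebra.TensorProduct.assoc k k k A A A).toAlgHom.comp
        (Algebra.TensorProduct.map (Algebra.TensorProduct.map S.val S.val) S.val) := by
    ext <;> rfl
  have e2 : (Algebra.TensorProduct.map (Algebra.TensorProduct.map S.val S.val) S.val).comp
      (Algebra.TensorProduct.map hS.comul (.id k S)) =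
      (Algebra.TensorProduct.map (Bialgebra.comulAlgHom k A) (.id k A)).comp
        (Algebra.TensorProduct.map S.val S.val) := by
    rw [← Algebra.TensorProduct.map_comp, ← Algebra.TensorProduct.map_comp, hS.map_comp_comul]
    rfl
  have e3 : (Algebra.TensorProduct.map S.val (Algebra.TensorProduct.map S.val S.val)).comp
      (Algebra.TensorProduct.map (.id k S) hS.comul) =
      (Algebra.TensorProduct.map (.id k A) (Bialgebra.comulAlgHom k A)).comp
        (Algebra.TensorProduct.map S.val S.val) := by
    rw [← Algebra.TensorProduct.map_comp, ← Algebra.TensorProduct.map_comp, hS.map_comp_comul]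
    rfl
  ext a
  apply inj
  have h1 := fun x ↦ DFunLike.congr_fun e1 x
  have h2 := fun x ↦ DFunLike.congr_fun e2 x
  have h3 := fun x ↦ DFunLike.congr_fun e3 x
  have h4 := DFunLike.congr_fun hS.map_comp_comul a
  simp only [AlgHom.comp_apply] at h1 h2 h3 h4 ⊢
  rw [h1, h2, h3, h4]
  exact Coalgebra.coassoc_apply (R := k) (a : A)

theorem comul_rTensor_counit :
    (Algebra.TensorProduct.map ((Bialgebra.counitAlgHom k A).comp S.val) (.id k S)).comp hS.comul =
      (Algebra.TensorProduct.lid k S).symm := by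
  have inj : Function.Injective (Algebra.TensorProduct.map (.id k k) S.val) :=
    TensorProduct.map_injective_of_flat_flat LinearMap.id S.val.toLinearMap
      Function.injective_id Subtype.val_injective
  have e1 : (Algebra.TensorProduct.map (.id k k) S.val).comp
      (Algebra.TensorProduct.map ((Bialgebra.counitAlgHom k A).comp S.val) (.id k S)) =
      (Algebra.TensorProduct.map (Bialgebra.counitAlgHom k A) (.id k A)).comp
        (Algebra.TensorProduct.map S.val S.val) := by
    ext <;> rfl
  ext a
  apply inj
  have h1 := fun x ↦ DFunLike.congr_fun e1 x
  have h4 := DFunLike.congr_fun hS.map_comp_comul a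
  simp only [AlgHom.comp_apply] at h1 h4 ⊢
  rw [h1, h4]
  exact Coalgebra.rTensor_counit_comul (R := k) (a : A)

theorem comul_lTensor_counit :
    (Algebra.TensorProduct.map (.id k S) ((Bialgebra.counitAlgHom k A).comp S.val)).comp hS.comul =
      (Algebra.TensorProduct.rid k k S).symm := by
  have inj : Function.Injective (Algebra.TensorProduct.map S.val (.id k k)) :=
    TensorProduct.map_injective_of_flat_flat S.val.toLinearMap LinearMap.id
      Subtype.val_injective Function.injective_id
  have e1 : (Algebra.TensorProduct.map S.val (.id k k)).comp
      (Algebra.TensorProduct.map (.id k S) ((Bialgebra.counitAlgHom k A).comp S.val)) =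
      (Algebra.TensorProduct.map (.id k A) (Bialgebra.counitAlgHom k A)).comp
        (Algebra.TensorProduct.map S.val S.val) := by
    ext <;> rfl
  ext a
  apply inj
  have h1 := fun x ↦ DFunLike.congr_fun e1 x
  have h4 := DFunLike.congr_fun hS.map_comp_comul a
  simp only [AlgHom.comp_apply] at h1 h4 ⊢
  rw [h1, h4]
  exact Coalgebra.lTensor_counit_comul (R := k) (a : A)

/-- The bialgebra structure of a Hopf subalgebra, restricting the one of `A`. -/
noncomputable abbrev bialgebra : Bialgebra k S :=
  Bialgebra.ofAlgHom hS.comul ((Bialgebra.counitAlgHom k A).comp S.val)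
    hS.comul_coassoc hS.comul_rTensor_counit hS.comul_lTensor_counit

/-- The Hopf algebra structure of a Hopf subalgebra, restricting the one of `A`. -/
noncomputable abbrev hopfAlgebra : HopfAlgebra k S :=
  letI := hS.bialgebra
  HopfAlgebra.ofAlgHom hS.antipode
    (by
      have e : S.val.toLinearMap ∘ₗ (Algebra.TensorProduct.lift hS.antipode (.id k S)
            fun _ ↦ Commute.all _).toLinearMap =
          LinearMap.mul' k A ∘ₗ (HopfAlgebra.antipode k).rTensor A ∘ₗ
            (Algebra.TensorProduct.map S.val S.val).toLinearMap := by
        ext; rfl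
      ext a
      refine (DFunLike.congr_fun e (hS.comul a)).trans ?_
      refine (congrArg (fun x ↦ LinearMap.mul' k A ((HopfAlgebra.antipode k).rTensor A x))
        (DFunLike.congr_fun hS.map_comp_comul a)).trans ?_
      exact HopfAlgebra.mul_antipode_rTensor_comul_apply (a : A))
    (by
      have e : S.val.toLinearMap ∘ₗ (Algebra.TensorProduct.lift (.id k S) hS.antipode
            fun _ _ ↦ Commute.all _ _).toLinearMap =
          LinearMap.mul' k A ∘ₗ (HopfAlgebra.antipode k).lTensor A ∘ₗ
            (Algebra.TensorProduct.map S.val S.val).toLinearMap := by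
        ext; rfl
      ext a
      refine (DFunLike.congr_fun e (hS.comul a)).trans ?_
      refine (congrArg (fun x ↦ LinearMap.mul' k A ((HopfAlgebra.antipode k).lTensor A x))
        (DFunLike.congr_fun hS.map_comp_comul a)).trans ?_
      exact HopfAlgebra.mul_antipode_lTensor_comul_apply (a : A))

/-- The inclusion of a Hopf subalgebra. -/
noncomputable def incl : letI := hS.hopfAlgebra; S →ₐc[k] A :=
  letI := hS.hopfAlgebra
  BialgHom.ofAlgHom S.val rfl hS.map_comp_comul

end IsHopfSubalgebra

section Map

variable {B : Type u} [CommRing B] [HopfAlgebra k B]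

theorem bialgHom_antipode (f : A →ₐc[k] B) (a : A) :
    f (HopfAlgebra.antipode k a) = HopfAlgebra.antipode k (f a) := by
  have h : (WithConv.toConv (f : A →ₐ[k] B))⁻¹ =
      WithConv.toConv ((HopfAlgebra.antipodeAlgHom k B).comp (f : A →ₐ[k] B)) := by
    refine (eq_inv_of_mul_eq_one_left ?_).symm
    have := AlgHom.convMul_comp_bialgHom_distrib
      (WithConv.toConv (HopfAlgebra.antipodeAlgHom k B)) (WithConv.toConv (AlgHom.id k B)) f
    rw [AlgHom.antipode_id_cancel] at this
    refine (WithConv.ext this).symm.trans ?_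
    ext a
    simp
  exact DFunLike.congr_fun (congrArg WithConv.ofConv h) a

theorem IsHopfSubalgebra.map {S : Subalgebra k A} (hS : IsHopfSubalgebra S) (f : A →ₐc[k] B) :
    IsHopfSubalgebra (S.map (f : A →ₐ[k] B)) where
  comul_mem := by
    rintro _ ⟨a, ha, rfl⟩
    obtain ⟨x, hx⟩ := hS.comul_mem a ha
    let g : S →ₐ[k] S.map (f : A →ₐ[k] B) :=
      ((f : A →ₐ[k] B).comp S.val).codRestrict _ fun s ↦ ⟨s, s.2, rfl⟩
    refine ⟨Algebra.TensorProduct.map g g x, ?_⟩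
    have e : (Algebra.TensorProduct.map (S.map (f : A →ₐ[k] B)).val
        (S.map (f : A →ₐ[k] B)).val).comp (Algebra.TensorProduct.map g g) =
        (Algebra.TensorProduct.map (f : A →ₐ[k] B) (f : A →ₐ[k] B)).comp
          (Algebra.TensorProduct.map S.val S.val) := by
      ext <;> rfl
    refine (DFunLike.congr_fun e x).trans ?_
    refine (congrArg (Algebra.TensorProduct.map (f : A →ₐ[k] B) (f : A →ₐ[k] B)) hx).trans ?_
    exact CoalgHomClass.map_comp_comul_apply f a
  antipode_mem := by
    rintro _ ⟨a, ha, rfl⟩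
    exact ⟨_, hS.antipode_mem a ha, bialgHom_antipode f a⟩

theorem etale_map {A B : Type u} [CommRing A] [CommRing B] [Algebra k A] [Algebra k B]
    (S : Subalgebra k A) [Algebra.Etale k S] (f : A →ₐ[k] B) : Algebra.Etale k (S.map f) := by
  let g : S →ₐ[k] S.map f := (f.comp S.val).codRestrict _ fun s ↦ ⟨s, s.2, rfl⟩
  have hg : Function.Surjective g := by
    rintro ⟨_, a, ha, rfl⟩
    exact ⟨⟨a, ha⟩, rfl⟩
  have : Algebra.FiniteType k (S.map f) := Algebra.FiniteType.of_surjective g hg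
  have := Algebra.FormallyUnramified.of_surjective g hg
  exact ⟨Algebra.FormallyEtale.of_formallyUnramified_of_field k _,
    Algebra.FinitePresentation.of_finiteType.mp inferInstance⟩

theorem etaleHopfPart_le_comap (f : A →ₐc[k] B) :
    etaleHopfPart k A ≤ (etaleHopfPart k B).comap (f : A →ₐ[k] B) := by
  refine sSup_le fun S hS ↦ ?_
  have := hS.2
  rw [← Subalgebra.map_le]
  exact le_sSup ⟨hS.1.map f, etale_map S _⟩

end Map

/-- The Hopf algebra structure on the étale part, restricting the one of `A`. -/
noncomputable instance : HopfAlgebra k (etaleHopfPart k A) :=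
  isHopfSubalgebra_etaleHopfPart.hopfAlgebra

/-- The restriction of a morphism of Hopf algebras to the étale parts. -/
noncomputable def etaleHopfPartMap {B : Type u} [CommRing B] [HopfAlgebra k B] (f : A →ₐc[k] B) :
    etaleHopfPart k A →ₐc[k] etaleHopfPart k B :=
  BialgHom.ofAlgHom
    (((f : A →ₐ[k] B).comp (etaleHopfPart k A).val).codRestrict _
      fun a ↦ etaleHopfPart_le_comap f a.2)
    (by
      ext a
      exact CoalgHomClass.counit_comp_apply f (a : A))
    (by
      set g := ((f : A →ₐ[k] B).comp (etaleHopfPart k A).val).codRestrict (etaleHopfPart k B)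
        fun a ↦ etaleHopfPart_le_comap f a.2
      ext a
      apply map_val_injective
      have e : (Algebra.TensorProduct.map (etaleHopfPart k B).val (etaleHopfPart k B).val).comp
          (Algebra.TensorProduct.map g g) =
          (Algebra.TensorProduct.map (f : A →ₐ[k] B) (f : A →ₐ[k] B)).comp
          (Algebra.TensorProduct.map (etaleHopfPart k A).val (etaleHopfPart k A).val) := by
        ext <;> rfl
      have hA := DFunLike.congr_fun
        (isHopfSubalgebra_etaleHopfPart (k := k) (A := A)).map_comp_comul a
      have hB := DFunLike.congr_fun
        (isHopfSubalgebra_etaleHopfPart (k := k) (A := B)).map_comp_comul (g a)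
      refine (DFunLike.congr_fun e _).trans ?_
      refine (congrArg (Algebra.TensorProduct.map (f : A →ₐ[k] B) (f : A →ₐ[k] B)) hA).trans ?_
      refine (CoalgHomClass.map_comp_comul_apply f (a : A)).trans ?_
      exact hB.symm)

end HopfSubalgebras

/-- The category of `k`-groups (affine group schemes over `k`): the opposite of the category of
commutative Hopf algebras over `k`. The Hopf algebra `k[G]` of `G : KGroup k` is `G.unop`, and a
morphism `f : G ⟶ H` is given by its dual map `f.unop.hom : k[H] → k[G]`. -/
abbrev KGroup (k : Type u) [Field k] := (CommHopfAlgCat.{u} k)ᵒᵖ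

namespace KGroup

variable {k : Type u} [Field k]

/-- The coordinate Hopf algebra `k[G]`. -/
abbrev coord (G : KGroup k) : Type u := G.unop

/-- The dual map `k[H] → k[G]` of a morphism `G ⟶ H`. -/
abbrev dual {G H : KGroup k} (f : G ⟶ H) : H.coord →ₐc[k] G.coord := f.unop.hom

/-- A `k`-group is connected if its underlying scheme `Spec k[G]` is connected. -/
def IsConnected (G : KGroup k) : Prop := ConnectedSpace (PrimeSpectrum G.coord)

variable (k) in
/-- The functor `G ↦ G^et`, the maximal pro-étale quotient. Quotients of `G` correspond to Hopf
subalgebras of `k[G]`, and `k[G^et]` is the union of all étale Hopf subalgebras, i.e. `G^et` is the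
limit of all étale quotients of `G`. -/
noncomputable def et : KGroup k ⥤ KGroup k where
  obj G := op (.of k (etaleHopfPart k G.coord))
  map f := (CommHopfAlgCat.ofHom (etaleHopfPartMap (dual f))).op

variable (k) in
/-- The canonical quotient maps `G ⟶ G^et`, dual to the inclusions of Hopf algebras. -/
noncomputable def toEt : 𝟭 (KGroup k) ⟶ et k where
  app G := (CommHopfAlgCat.ofHom isHopfSubalgebra_etaleHopfPart.incl).op

/-- `q : G ⟶ E` exhibits `E` as the `k`-group `π₀(G)` of connected components of `G`: the dual map
identifies `k[E]` with the largest separable subalgebra `π₀(k[G])` of `k[G]`. Such a `q` is unique up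
to a unique isomorphism. -/
structure IsPi0 {G E : KGroup k} (q : G ⟶ E) : Prop where
  injective : Function.Injective (dual q)
  range_eq : (dual q : E.coord →ₐ[k] G.coord).range = separablePart k G.coord

end KGroup

/-! The map `G ⟶ π₀(G)` is initial among the morphisms `G ⟶ E` along which all functions on `E` pull
back to separable elements (`IsPi0.existsUnique_factor`). So `P` and `Q` have the same morphisms to
groups all of whose functions are separable, and comparing universal properties gives `π₀(P) ≅
π₀(Q)` (`isIso_of_isPushout`).

The substance lies in showing that the largest separable subalgebra of a commutative Hopf algebra is
generated by étale Hopf subalgebras (`etaleHopfPart_eq_separablePart`). Separability is tested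
element by element through a polynomial (`mem_separablePart_iff`), hence is preserved by algebra
maps such as the comultiplication and the antipode. The key is that slices of a separable element of
`A ⊗ B` are separable (`isSeparableRoot_leftSlice`). After reduction to finite type over an
algebraically closed field, such an element is a combination of idempotents; an idempotent of `A ⊗
B` does not vary along a connected component of `Spec A`, so its slices take finitely many values.
By coassociativity each separable element then lies in a finite dimensional subcoalgebra of
separable elements, which with its image under the antipode generates an étale Hopf subalgebra.

For the corollary, separable functions on a connected group are constant, so `P ⟶ P^et` is trivial
on both factors and hence trivial. Idempotents are separable, so those of `k[P]` are constants. -/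

/-! ### Separable elements and étale subalgebras. -/

section SeparableElements

open Polynomial

/-- An element of a `k`-algebra is separable if it is a root of a separable polynomial. -/
def IsSeparableRoot (k : Type u) {A : Type u} [Field k] [CommRing A] [Algebra k A] (y : A) : Prop :=
  ∃ p : k[X], p.Separable ∧ aeval y p = 0

variable {k A B : Type u} [Field k] [CommRing A] [Algebra k A] [CommRing B] [Algebra k B]

theorem IsSeparableRoot.map {y : A} (hy : IsSeparableRoot k y) (f : A →ₐ[k] B) :
    IsSeparableRoot k (f y) := by
  obtain ⟨p, hp, h⟩ := hy
  exact ⟨p, hp, by rw [aeval_algHom_apply, h, map_zero]⟩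

theorem IsSeparableRoot.of_injective {y : A} (f : A →ₐ[k] B) (hf : Function.Injective f)
    (hy : IsSeparableRoot k (f y)) : IsSeparableRoot k y := by
  obtain ⟨p, hp, h⟩ := hy
  exact ⟨p, hp, hf (by rw [← aeval_algHom_apply, h, map_zero])⟩

theorem IsSeparableRoot.extendScalars {K : Type u} [Field K] [Algebra k K] [Algebra K A]
    [IsScalarTower k K A] {y : A} (hy : IsSeparableRoot k y) : IsSeparableRoot K y := by
  obtain ⟨p, hp, h⟩ := hy
  exact ⟨p.map (algebraMap k K), hp.map, by rwa [aeval_map_algebraMap]⟩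

theorem etale_of_surjective [Algebra.Etale k A] (f : A →ₐ[k] B) (hf : Function.Surjective f) :
    Algebra.Etale k B := by
  have : Algebra.FiniteType k B := Algebra.FiniteType.of_surjective f hf
  have := Algebra.FormallyUnramified.of_surjective f hf
  exact ⟨Algebra.FormallyEtale.of_formallyUnramified_of_field k _,
    Algebra.FinitePresentation.of_finiteType.mp inferInstance⟩

/-- The algebra is a quotient of `k[X]/(p)`, which is standard étale once `p` is made monic, and
quotients of étale algebras over a field are étale. -/
theorem IsSeparableRoot.etale_of_adjoin_eq_top {y : A} (hy : IsSeparableRoot k y)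
    (h : Algebra.adjoin k {y} = ⊤) : Algebra.Etale k A := by
  obtain ⟨p, hp, hpy⟩ := hy
  have hp0 : p ≠ 0 := hp.ne_zero
  have hsep : (p * C p.leadingCoeff⁻¹).Separable :=
    hp.mul_unit (by simpa [isUnit_C] using hp0)
  let P : StandardEtalePair k :=
    { f := p * C p.leadingCoeff⁻¹
      monic_f := monic_mul_leadingCoeff_inv hp0
      g := 1
      cond := by
        obtain ⟨a, b, hab⟩ := hsep
        exact ⟨b, a, 1, by rw [pow_one, ← hab]; ring⟩ }
  have hP : P.HasMap y := ⟨by simp [P, hpy], by simp [P]⟩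
  refine etale_of_surjective (P.lift y hP) ?_
  rw [← AlgHom.range_eq_top, eq_top_iff, ← h, Algebra.adjoin_le_iff, Set.singleton_subset_iff]
  exact ⟨P.X, P.lift_X y hP⟩

theorem adjoin_singleton_self_eq_top (y : A) :
    Algebra.adjoin k {(⟨y, Algebra.self_mem_adjoin_singleton k y⟩ : Algebra.adjoin k {y})} = ⊤ := by
  have h := Algebra.adjoin_adjoin_coe_preimage (R := k) (s := ({y} : Set A))
  rw [← h]
  congr 1
  ext z
  exact Subtype.ext_iff

theorem IsSeparableRoot.etale_adjoin {y : A} (hy : IsSeparableRoot k y) :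
    Algebra.Etale k (Algebra.adjoin k {y}) := by
  refine IsSeparableRoot.etale_of_adjoin_eq_top
    (y := (⟨y, Algebra.self_mem_adjoin_singleton k y⟩ : Algebra.adjoin k {y})) ?_ ?_
  · exact hy.of_injective (Algebra.adjoin k {y}).val Subtype.val_injective
  · exact adjoin_singleton_self_eq_top y

theorem IsSeparableRoot.of_etale [Algebra.Etale k A] (y : A) : IsSeparableRoot k y := by
  classical
  obtain ⟨I, _, L, _, _, e, hL⟩ :=
    (Algebra.Etale.iff_exists_algEquiv_prod k A).mp inferInstance
  have := fun i ↦ (hL i).1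
  have := fun i ↦ (hL i).2
  have := Fintype.ofFinite I
  -- An étale algebra is a finite product of finite separable field extensions. Taking the image as
  -- a `Finset` drops repeated minimal polynomials, so the factors of the product below are pairwise
  -- coprime.
  let s := Finset.univ.image fun i ↦ minpoly k (e y i)
  have hirr : ∀ q ∈ s, Irreducible q ∧ q.Monic ∧ q.Separable := by
    intro q hq
    obtain ⟨i, -, rfl⟩ := Finset.mem_image.mp hq
    have hi : IsIntegral k (e y i) := Algebra.IsIntegral.isIntegral _
    exact ⟨minpoly.irreducible hi, minpoly.monic hi, Algebra.IsSeparable.isSeparable k _⟩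
  refine ⟨∏ q ∈ s, q, separable_prod' (fun q hq r hr hne ↦ ?_) fun q hq ↦ (hirr q hq).2.2,
    e.injective ?_⟩
  · refine ((hirr q hq).1.coprime_iff_not_dvd).mpr fun hdvd ↦ hne ?_
    exact eq_of_monic_of_associated (hirr q hq).2.1 (hirr r hr).2.1
      ((hirr q hq).1.associated_of_dvd (hirr r hr).1 hdvd)
  · rw [map_zero]
    funext i
    have h1 : e (aeval y (∏ q ∈ s, q)) i = aeval (e y i) (∏ q ∈ s, q) := by
      exact (aeval_algHom_apply ((Pi.evalAlgHom k L i).comp e.toAlgHom) y _).symm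
    rw [h1, map_prod]
    exact Finset.prod_eq_zero (Finset.mem_image_of_mem _ (Finset.mem_univ i)) (minpoly.aeval _ _)

/-- Étaleness of the subalgebra generated by `y` descends along the faithfully flat extension `K` of
`k`. -/
theorem IsSeparableRoot.of_baseChange {K : Type u} [Field K] [Algebra k K] {y : A}
    (hy : IsSeparableRoot K ((1 : K) ⊗ₜ[k] y)) : IsSeparableRoot k y := by
  let S := Algebra.adjoin k {y}
  let y' : S := ⟨y, Algebra.self_mem_adjoin_singleton k y⟩
  have hS : Algebra.adjoin k {y'} = ⊤ := adjoin_singleton_self_eq_top y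
  have inj : Function.Injective (Algebra.TensorProduct.map (.id K K) S.val) :=
    TensorProduct.map_injective_of_flat_flat (LinearMap.id : K →ₗ[k] K) S.val.toLinearMap
      Function.injective_id Subtype.val_injective
  have h1 : IsSeparableRoot K ((1 : K) ⊗ₜ[k] y') := by
    refine IsSeparableRoot.of_injective _ inj ?_
    simpa using hy
  have h2 : Algebra.adjoin K {(1 : K) ⊗ₜ[k] y'} = ⊤ := by
    rw [← Algebra.TensorProduct.adjoin_one_tmul_image_eq_top _ hS]
    simp
  have := h1.etale_of_adjoin_eq_top h2
  have : Algebra.Etale k S := Algebra.Etale.of_etale_tensorProduct_of_faithfullyFlat K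
  exact (IsSeparableRoot.of_etale y').map S.val

theorem etale_sup (S T : Subalgebra k A) [Algebra.Etale k S] [Algebra.Etale k T] :
    Algebra.Etale k ↥(S ⊔ T) := by
  have : Algebra.Etale k (S ⊗[k] T) := Algebra.Etale.comp k S _
  have h := Algebra.TensorProduct.productMap_range S.val T.val
  rw [Subalgebra.range_val, Subalgebra.range_val] at h
  rw [← h]
  exact etale_of_surjective (Algebra.TensorProduct.productMap S.val T.val).rangeRestrict
    (AlgHom.rangeRestrict_surjective _)

theorem etale_bot : Algebra.Etale k (⊥ : Subalgebra k A) :=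
  etale_of_surjective (Algebra.ofId k _) fun ⟨x, hx⟩ ↦ by
    obtain ⟨c, rfl⟩ := Algebra.mem_bot.mp hx
    exact ⟨c, rfl⟩

theorem etale_adjoin_finset (s : Finset A) (hs : ∀ y ∈ s, IsSeparableRoot k y) :
    Algebra.Etale k (Algebra.adjoin k (s : Set A)) := by
  classical
  induction s using Finset.induction_on with
  | empty => rw [Finset.coe_empty, Algebra.adjoin_empty]; exact etale_bot
  | insert y s _ ih =>
    have := ih fun z hz ↦ hs z (Finset.mem_insert_of_mem hz)
    have := (hs y (Finset.mem_insert_self y s)).etale_adjoin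
    rw [Finset.coe_insert, Set.insert_eq, Algebra.adjoin_union]
    exact etale_sup _ _

/-- Étale subalgebras are directed, since `S ⊔ T` is a quotient of `S ⊗ T`; each element of their
supremum therefore lies in a single one. -/
theorem mem_separablePart_iff {y : A} : y ∈ separablePart k A ↔ IsSeparableRoot k y := by
  refine ⟨fun h ↦ ?_, fun h ↦ ?_⟩
  · have hdir : DirectedOn (· ≤ ·) {S : Subalgebra k A | Algebra.Etale k S} := by
      rintro S (hS : Algebra.Etale k S) T (hT : Algebra.Etale k T)
      exact ⟨S ⊔ T, etale_sup S T, le_sup_left, le_sup_right⟩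
    have : Nonempty {S : Subalgebra k A | Algebra.Etale k S} := ⟨⟨⊥, etale_bot⟩⟩
    rw [separablePart, sSup_eq_iSup', ← SetLike.mem_coe,
      Subalgebra.coe_iSup_of_directed hdir.directed_val, Set.mem_iUnion] at h
    obtain ⟨⟨S, hS : Algebra.Etale k S⟩, hy⟩ := h
    exact (IsSeparableRoot.of_etale (⟨y, hy⟩ : S)).map S.val
  · exact (show Algebra.adjoin k {y} ≤ separablePart k A from le_sSup h.etale_adjoin)
      (Algebra.self_mem_adjoin_singleton k y)

end SeparableElements

/-! ### Slices, idempotents and components over an algebraically closed field. -/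

section Slices

open Polynomial

/-- The slice `(id ⊗ φ)(x)` of `x : A ⊗ B` along a linear form `φ` on `B`. -/
noncomputable def leftSlice {k A B : Type u} [Field k] [AddCommGroup A] [Module k A]
    [AddCommGroup B] [Module k B] (φ : B →ₗ[k] k) : A ⊗[k] B →ₗ[k] A :=
  (TensorProduct.rid k A).toLinearMap ∘ₗ φ.lTensor A

@[simp]
theorem leftSlice_tmul {k A B : Type u} [Field k] [AddCommGroup A] [Module k A]
    [AddCommGroup B] [Module k B] (φ : B →ₗ[k] k) (a : A) (b : B) :
    leftSlice φ (a ⊗ₜ[k] b) = φ b • a := by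
  simp [leftSlice]

section AlgClosed

variable {K A B : Type u} [Field K] [CommRing A] [Algebra K A] [CommRing B] [Algebra K B]

theorem exists_algHom_of_isMaximal [IsAlgClosed K] [Algebra.FiniteType K A] (m : Ideal A)
    [m.IsMaximal] : ∃ χ : A →ₐ[K] K, ∀ a, χ a = 0 ↔ a ∈ m := by
  let := Ideal.Quotient.field m
  have := finite_of_finite_type_of_isJacobsonRing K (A ⧸ m)
  have hb := IsAlgClosed.algebraMap_bijective_of_isIntegral (k := K) (K := A ⧸ m)
  refine ⟨(AlgEquiv.ofBijective (Algebra.ofId K (A ⧸ m)) hb).symm.toAlgHom.comp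
    (Ideal.Quotient.mkₐ K m), fun a ↦ ?_⟩
  rw [← Ideal.Quotient.eq_zero_iff_mem]
  exact map_eq_zero_iff _ (AlgEquiv.ofBijective (Algebra.ofId K (A ⧸ m)) hb).symm.injective

theorem isNilpotent_of_forall_algHom [IsAlgClosed K] [Algebra.FiniteType K A] {a : A}
    (h : ∀ χ : A →ₐ[K] K, χ a = 0) : IsNilpotent a := by
  have : IsJacobsonRing A := isJacobsonRing_of_finiteType (A := K)
  rw [← mem_nilradical, nilradical, Ideal.radical_eq_jacobson, Ideal.jacobson, Ideal.mem_sInf]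
  rintro m ⟨-, hm⟩
  obtain ⟨χ, hχ⟩ := exists_algHom_of_isMaximal (K := K) m
  exact (hχ a).mp (h χ)

/-- Modulo each of the finitely many minimal primes an idempotent is 0 or 1. These values determine
it up to a nilpotent, hence exactly. -/
theorem finite_isIdempotentElem [IsNoetherianRing A] : {e : A | IsIdempotentElem e}.Finite := by
  have hfin : (minimalPrimes A).Finite := minimalPrimes.finite_of_isNoetherianRing A
  refine Set.Finite.of_finite_image (f := fun e ↦ {p ∈ minimalPrimes A | e ∈ p})
    (hfin.finite_subsets.subset ?_) ?_
  · rintro _ ⟨e, -, rfl⟩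
    exact fun p hp ↦ hp.1
  · intro e (he : IsIdempotentElem e) f (hf : IsIdempotentElem f) hef
    refine eq_of_isNilpotent_sub_of_isIdempotentElem he hf ?_
    rw [← mem_nilradical, nilradical, ← Ideal.sInf_minimalPrimes, Ideal.mem_sInf]
    intro p hp
    have hpp : p.IsPrime := hp.1.1
    have hiff : e ∈ p ↔ f ∈ p := by
      have := Set.ext_iff.mp hef p
      simp only [Set.mem_ofPred_eq] at this
      tauto
    by_cases hep : e ∈ p
    · exact p.sub_mem hep (hiff.mp hep)
    · have h1 : 1 - e ∈ p := (hpp.mem_or_mem (show e * (1 - e) ∈ p by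
        rw [mul_sub, mul_one, he.eq, sub_self]; exact p.zero_mem)).resolve_left hep
      have h2 : 1 - f ∈ p := (hpp.mem_or_mem (show f * (1 - f) ∈ p by
        rw [mul_sub, mul_one, hf.eq, sub_self]; exact p.zero_mem)).resolve_left
          (fun h ↦ hep (hiff.mpr h))
      convert p.sub_mem h2 h1 using 1
      ring

/-- The idempotent of the connected component of a rational point. -/
theorem exists_idempotent_component [IsNoetherianRing A] (h : A →ₐ[K] K) :
    ∃ a : A, IsIdempotentElem a ∧ h a = 1 ∧ ∀ u, IsIdempotentElem u → u * a = h u • a := by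
  classical
  -- The component is cut out by the product of all idempotents with value 1 at `h`. If `h u = 0`,
  -- then `1 - u` is among the factors.
  let s := (finite_isIdempotentElem (A := A)).toFinset.filter fun e ↦ h e = 1
  have hs : ∀ e, e ∈ s ↔ IsIdempotentElem e ∧ h e = 1 := fun e ↦ by simp [s]
  have key : ∀ u ∈ s, u * ∏ e ∈ s, e = ∏ e ∈ s, e := fun u hu ↦ by
    rw [← Finset.mul_prod_erase s (fun e ↦ e) hu, ← mul_assoc, ((hs u).mp hu).1.eq]
  refine ⟨∏ e ∈ s, e, ?_, ?_, fun u hu ↦ ?_⟩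
  · rw [IsIdempotentElem, ← Finset.prod_mul_distrib]
    exact Finset.prod_congr rfl fun e he ↦ ((hs e).mp he).1.eq
  · rw [map_prod]
    exact Finset.prod_eq_one fun e he ↦ ((hs e).mp he).2
  · rcases IsIdempotentElem.iff_eq_zero_or_one.mp (hu.map h) with h0 | h1
    · have := key (1 - u) ((hs _).mpr ⟨hu.one_sub, by rw [map_sub, h0, map_one, sub_zero]⟩)
      rw [sub_mul, one_mul, sub_eq_self] at this
      rw [this, h0, zero_smul]
    · rw [key u ((hs u).mpr ⟨hu, h1⟩), h1, one_smul]

theorem leftSlice_mul_tmul_one (φ : B →ₗ[K] K) (x : A ⊗[K] B) (a : A) :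
    leftSlice φ (x * a ⊗ₜ[K] 1) = leftSlice φ x * a := by
  induction x with
  | zero => simp
  | tmul c d => simp
  | add x y hx hy => rw [add_mul, map_add, hx, hy, map_add, add_mul]

/-- An idempotent of `A ⊗ B` is constant along the connected components of `Spec A`. -/
theorem idempotent_mul_component [IsAlgClosed K] [Algebra.FiniteType K A] [Algebra.FiniteType K B]
    {e : A ⊗[K] B} (he : IsIdempotentElem e) {h : A →ₐ[K] K} {a : A} (ha : IsIdempotentElem a)
    (hau : ∀ u, IsIdempotentElem u → u * a = h u • a) :
    ∃ f : B, e * a ⊗ₜ[K] 1 = a ⊗ₜ[K] f := by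
  have : Algebra.FiniteType K (A ⊗[K] B) := .trans (S := A) inferInstance inferInstance
  -- `f` is the restriction of `e` to the fibre over the point `h`.
  let f : B := Algebra.TensorProduct.lift ((Algebra.ofId K B).comp h) (.id K B)
    (fun _ _ ↦ Commute.all _ _) e
  have hf : IsIdempotentElem f := he.map _
  refine ⟨f, eq_of_isNilpotent_sub_of_isIdempotentElem ?_ ?_ (isNilpotent_of_forall_algHom
    (K := K) fun χ ↦ ?_)⟩
  · exact he.mul (ha.map (Algebra.TensorProduct.includeLeft : A →ₐ[K] A ⊗[K] B))
  · rw [IsIdempotentElem, Algebra.TensorProduct.tmul_mul_tmul, ha.eq, hf.eq]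
  -- At a point `χ = (h', g)`, the restriction `r e` of `e` to `Spec A × {g}` is an idempotent of
  -- `A`, so `hau` replaces its value at `h'` by its value at `h`, which is `g f`, wherever `a` does
  -- not vanish.
  · let h' : A →ₐ[K] K := χ.comp Algebra.TensorProduct.includeLeft
    let g : B →ₐ[K] K := χ.comp Algebra.TensorProduct.includeRight
    let r : A ⊗[K] B →ₐ[K] A := Algebra.TensorProduct.lift (.id K A) ((Algebra.ofId K A).comp g)
      (fun _ _ ↦ Commute.all _ _)
    have e1 : χ = h'.comp r := by
      ext
      · simp [r, h']
      · simp [r, g]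
    have e2 : g.comp (Algebra.TensorProduct.lift ((Algebra.ofId K B).comp h) (.id K B)
        (fun _ _ ↦ Commute.all _ _)) = h.comp r := by
      ext
      · simp [r]
      · simp [r]
    have e2' : g f = h (r e) := DFunLike.congr_fun e2 e
    have e3 := congrArg h' (hau (r e) (he.map r))
    have e4 : χ e = h' (r e) := DFunLike.congr_fun e1 e
    have e5 : χ (a ⊗ₜ[K] f) = h' a * g f := by
      rw [← mul_one a, ← one_mul f, ← Algebra.TensorProduct.tmul_mul_tmul, map_mul, mul_one,
        one_mul]
      rfl
    have e6 : χ (a ⊗ₜ[K] 1) = h' a := rfl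
    rw [map_mul, map_smul, smul_eq_mul] at e3
    rw [map_sub, map_mul, e4, e5, e6, e2', e3, mul_comm, sub_self]

/-- On each component `e` has the form `1 ⊗ f`, so its slice is the constant `φ f` there. With
finitely many components, the slice is a root of a product of distinct linear factors. -/
theorem isSeparableRoot_leftSlice_idempotent [IsAlgClosed K] [Algebra.FiniteType K A]
    [Algebra.FiniteType K B] {e : A ⊗[K] B} (he : IsIdempotentElem e) (φ : B →ₗ[K] K) :
    IsSeparableRoot K (leftSlice φ e) := by
  classical
  have : IsNoetherianRing A := Algebra.FiniteType.isNoetherianRing K A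
  set y := leftSlice φ e
  have hpt : ∀ h : A →ₐ[K] K, ∃ a : A, IsIdempotentElem a ∧ h a = 1 ∧ ∃ c : K, y * a = c • a := by
    intro h
    obtain ⟨a, ha, ha1, hau⟩ := exists_idempotent_component h
    obtain ⟨f, hf⟩ := idempotent_mul_component he ha hau
    exact ⟨a, ha, ha1, φ f, by rw [← leftSlice_mul_tmul_one, hf, leftSlice_tmul]⟩
  let T : Set K := {c | ∃ a : A, IsIdempotentElem a ∧ a ≠ 0 ∧ y * a = c • a}
  have hT : T.Finite := by
    -- A nonzero idempotent determines the scalar, so `T` is covered by the image of the finite set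
    -- of idempotents.
    let F : A → K := fun a ↦ if h : ∃ c : K, y * a = c • a then h.choose else 0
    refine ((finite_isIdempotentElem (A := A)).image F).subset ?_
    rintro c ⟨a, ha, ha0, hc⟩
    refine ⟨a, ha, ?_⟩
    have hex : ∃ c : K, y * a = c • a := ⟨c, hc⟩
    have h1 : F a = hex.choose := dif_pos hex
    exact h1.trans (smul_left_injective K ha0 (hc.symm.trans hex.choose_spec)).symm
  let p : K[X] := ∏ c ∈ hT.toFinset, (X - C c)
  refine ⟨p, separable_prod_X_sub_C_iff'.mpr fun _ _ _ _ h ↦ h, ?_⟩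
  -- The annihilator of `p(y)` lies in no maximal ideal: it contains the idempotent of the component
  -- of each closed point, which has value 1 at that point.
  have htop : Ideal.torsionOf A A (aeval y p) = ⊤ := by
    by_contra hne
    obtain ⟨m, hm, hle⟩ := Ideal.exists_le_maximal _ hne
    obtain ⟨h, hh⟩ := exists_algHom_of_isMaximal (K := K) m
    obtain ⟨a, ha, ha1, c, hc⟩ := hpt h
    have ha0 : a ≠ 0 := by rintro rfl; simp at ha1
    have hcT : c ∈ hT.toFinset := hT.mem_toFinset.mpr ⟨a, ha, ha0, hc⟩
    refine one_ne_zero (ha1.symm.trans ((hh a).mpr (hle ?_)))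
    rw [Ideal.mem_torsionOf_iff, smul_eq_mul, map_prod, ← Finset.mul_prod_erase _ _ hcT,
      ← mul_assoc]
    have : a * aeval y (X - C c) = 0 := by
      rw [map_sub, aeval_X, aeval_C, mul_sub, mul_comm a y, hc, mul_comm a, ← Algebra.smul_def,
        sub_self]
    rw [this, zero_mul]
  have h1 : (1 : A) ∈ Ideal.torsionOf A A (aeval y p) := htop ▸ Submodule.mem_top
  rwa [Ideal.mem_torsionOf_iff, one_smul] at h1

/-- The étale algebra `K[x]` is a finite power of `K`, spanned by its coordinate idempotents. -/
theorem IsSeparableRoot.mem_span_idempotents [IsAlgClosed K] {x : A} (hx : IsSeparableRoot K x) :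
    x ∈ Submodule.span K {e : A | IsIdempotentElem e} := by
  classical
  let E := Algebra.adjoin K {x}
  have : Algebra.Etale K E := hx.etale_adjoin
  have := Algebra.FormallyUnramified.finite_of_free K E
  have : IsArtinianRing E := isArtinian_of_tower K inferInstance
  have : Fintype (PrimeSpectrum E) := Fintype.ofFinite _
  let q := Algebra.FormallyEtale.equivPiOfIsSepClosed K E
  let x' : E := ⟨x, Algebra.self_mem_adjoin_singleton K x⟩
  have h1 : x = ∑ i, q x' i • E.val (q.symm (Pi.single i 1)) := by
    have h2 : q x' = ∑ i, q x' i • (Pi.single i 1 : PrimeSpectrum E → K) := by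
      ext j
      simp [Finset.sum_apply, Pi.single_apply]
    have h3 := congrArg (fun z ↦ E.val (q.symm z)) h2
    simpa using h3
  rw [h1]
  refine Submodule.sum_mem _ fun i _ ↦ Submodule.smul_mem _ _ (Submodule.subset_span ?_)
  have h4 : IsIdempotentElem (Pi.single i 1 : PrimeSpectrum E → K) := by
    rw [IsIdempotentElem, ← Pi.single_mul, one_mul]
  exact (h4.map q.symm).map E.val

theorem isSeparableRoot_leftSlice_of_isAlgClosed [IsAlgClosed K] [Algebra.FiniteType K A]
    [Algebra.FiniteType K B] {x : A ⊗[K] B} (hx : IsSeparableRoot K x) (φ : B →ₗ[K] K) :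
    IsSeparableRoot K (leftSlice φ x) := by
  rw [← mem_separablePart_iff]
  have : Submodule.span K {e : A ⊗[K] B | IsIdempotentElem e} ≤
      (Subalgebra.toSubmodule (separablePart K A)).comap (leftSlice φ) :=
    Submodule.span_le.mpr fun e he ↦
      mem_separablePart_iff.mpr (isSeparableRoot_leftSlice_idempotent he φ)
  exact this hx.mem_span_idempotents

end AlgClosed

end Slices

/-! ### Slices of separable elements over an arbitrary field. -/

section SlicesOverField

variable {k A B : Type u} [Field k] [CommRing A] [Algebra k A] [CommRing B] [Algebra k B]

theorem isSeparableRoot_leftSlice_of_finiteType [Algebra.FiniteType k A] [Algebra.FiniteType k B]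
    {x : A ⊗[k] B} (hx : IsSeparableRoot k x) (φ : B →ₗ[k] k) :
    IsSeparableRoot k (leftSlice φ x) := by
  let K := AlgebraicClosure k
  let θ : A ⊗[k] B →ₐ[k] (K ⊗[k] A) ⊗[K] (K ⊗[k] B) := Algebra.TensorProduct.lift
    (((Algebra.TensorProduct.includeLeft :
      K ⊗[k] A →ₐ[K] (K ⊗[k] A) ⊗[K] (K ⊗[k] B)).restrictScalars k).comp
        Algebra.TensorProduct.includeRight)
    (((Algebra.TensorProduct.includeRight :
      K ⊗[k] B →ₐ[K] (K ⊗[k] A) ⊗[K] (K ⊗[k] B)).restrictScalars k).comp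
        Algebra.TensorProduct.includeRight)
    (fun _ _ ↦ Commute.all _ _)
  let φK : K ⊗[k] B →ₗ[K] K :=
    (TensorProduct.AlgebraTensorModule.rid k K K).toLinearMap ∘ₗ φ.baseChange K
  -- Slicing commutes with base change to the algebraic closure, from which separability descends.
  have h1 : ∀ z, leftSlice φK (θ z) = (1 : K) ⊗ₜ[k] leftSlice φ z := by
    intro z
    induction z using TensorProduct.induction_on with
    | zero => simp
    | tmul a b =>
      have : θ (a ⊗ₜ b) = ((1 : K) ⊗ₜ[k] a) ⊗ₜ[K] ((1 : K) ⊗ₜ[k] b) := by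
        simp [θ]
      rw [this, leftSlice_tmul, leftSlice_tmul]
      simp [φK]
    | add x y hx hy => rw [map_add, map_add, hx, hy, map_add, TensorProduct.tmul_add]
  refine IsSeparableRoot.of_baseChange (K := K) ?_
  rw [← h1]
  exact isSeparableRoot_leftSlice_of_isAlgClosed (hx.map θ).extendScalars φK

/-- The slices of a separable element of `A ⊗ B` are separable. -/
theorem isSeparableRoot_leftSlice {x : A ⊗[k] B} (hx : IsSeparableRoot k x) (φ : B →ₗ[k] k) :
    IsSeparableRoot k (leftSlice φ x) := by
  classical
  obtain ⟨s, rfl⟩ := TensorProduct.exists_finset x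
  let A' := Algebra.adjoin k (s.image Prod.fst : Set A)
  let B' := Algebra.adjoin k (s.image Prod.snd : Set B)
  have : Algebra.FiniteType k A' :=
    A'.fg_iff_finiteType.mp (Subalgebra.fg_adjoin_finset _)
  have : Algebra.FiniteType k B' :=
    B'.fg_iff_finiteType.mp (Subalgebra.fg_adjoin_finset _)
  obtain ⟨x', hx'⟩ : ∑ i ∈ s, i.1 ⊗ₜ[k] i.2 ∈
      (Algebra.TensorProduct.map A'.val B'.val).range := by
    refine Subalgebra.sum_mem _ fun i hi ↦ ?_
    exact ⟨⟨i.1, Algebra.subset_adjoin (Finset.mem_image_of_mem _ hi)⟩ ⊗ₜ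
      ⟨i.2, Algebra.subset_adjoin (Finset.mem_image_of_mem _ hi)⟩, rfl⟩
  have inj : Function.Injective (Algebra.TensorProduct.map A'.val B'.val) :=
    TensorProduct.map_injective_of_flat_flat A'.val.toLinearMap B'.val.toLinearMap
      Subtype.val_injective Subtype.val_injective
  have h1 : leftSlice φ ∘ₗ (Algebra.TensorProduct.map A'.val B'.val).toLinearMap =
      A'.val.toLinearMap ∘ₗ leftSlice (φ ∘ₗ B'.val.toLinearMap) := by
    ext a b
    simp
  change _ = _ at hx'
  rw [← hx'] at hx ⊢
  have h2 := isSeparableRoot_leftSlice_of_finiteType (hx.of_injective _ inj)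
    (φ ∘ₗ B'.val.toLinearMap)
  exact (DFunLike.congr_fun h1 x') ▸ h2.map A'.val

end SlicesOverField

/-! ### Elements of a tensor product determined by their slices. -/

section SliceCriterion

variable {k A B : Type u} [Field k] [AddCommGroup A] [Module k A] [AddCommGroup B] [Module k B]

/-- The slice `(φ ⊗ id)(x)` of `x : A ⊗ B` along a linear form `φ` on `A`. -/
noncomputable def rightSlice (φ : A →ₗ[k] k) : A ⊗[k] B →ₗ[k] B :=
  leftSlice φ ∘ₗ (TensorProduct.comm k A B).toLinearMap

@[simp]
theorem rightSlice_tmul (φ : A →ₗ[k] k) (a : A) (b : B) :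
    rightSlice φ (a ⊗ₜ[k] b) = φ a • b := by
  simp [rightSlice]

theorem eq_of_leftSlice_eq {x y : A ⊗[k] B} (h : ∀ φ : B →ₗ[k] k, leftSlice φ x = leftSlice φ y) :
    x = y := by
  classical
  let b := Module.Basis.ofVectorSpace k B
  have h1 : ∀ z : A ⊗[k] B, ∀ i, TensorProduct.equivFinsuppOfBasisRight b z i =
      leftSlice (b.coord i) z := by
    intro z i
    induction z using TensorProduct.induction_on with
    | zero => simp
    | tmul c d => simp
    | add z w hz hw => rw [map_add, map_add, Finsupp.add_apply, hz, hw]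
  refine (TensorProduct.equivFinsuppOfBasisRight b).injective (Finsupp.ext fun i ↦ ?_)
  rw [h1, h1, h]

theorem eq_of_rightSlice_eq {x y : A ⊗[k] B}
    (h : ∀ φ : A →ₗ[k] k, rightSlice φ x = rightSlice φ y) : x = y :=
  (TensorProduct.comm k A B).injective (eq_of_leftSlice_eq h)

/-- An element of `A ⊗ B` all of whose slices lie in `V` and `W` lies in `V ⊗ W`. -/
theorem mem_range_map_of_slices {V : Submodule k A} {W : Submodule k B} {x : A ⊗[k] B}
    (hV : ∀ φ, leftSlice φ x ∈ V) (hW : ∀ φ, rightSlice φ x ∈ W) :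
    x ∈ LinearMap.range (TensorProduct.map V.subtype W.subtype) := by
  -- `p` and `q` are linear projections onto `V` and `W`; the slices show that `x` is fixed by each
  -- of them, applied to its own tensor factor.
  obtain ⟨p, hp⟩ := LinearMap.exists_leftInverse_of_injective V.subtype V.ker_subtype
  obtain ⟨q, hq⟩ := LinearMap.exists_leftInverse_of_injective W.subtype W.ker_subtype
  have hp' : ∀ a ∈ V, (p a : A) = a := fun a ha ↦
    congrArg Subtype.val (DFunLike.congr_fun hp ⟨a, ha⟩)
  have hq' : ∀ b ∈ W, (q b : B) = b := fun b hb ↦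
    congrArg Subtype.val (DFunLike.congr_fun hq ⟨b, hb⟩)
  have h1 : TensorProduct.map (V.subtype ∘ₗ p) LinearMap.id x = x := by
    refine eq_of_leftSlice_eq fun φ ↦ ?_
    have : leftSlice φ ∘ₗ TensorProduct.map (V.subtype ∘ₗ p) LinearMap.id =
        (V.subtype ∘ₗ p) ∘ₗ leftSlice φ := by
      ext a b
      simp
    exact (DFunLike.congr_fun this x).trans (hp' _ (hV φ))
  have h2 : TensorProduct.map LinearMap.id (W.subtype ∘ₗ q) x = x := by
    refine eq_of_rightSlice_eq fun φ ↦ ?_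
    have : rightSlice φ ∘ₗ TensorProduct.map LinearMap.id (W.subtype ∘ₗ q) =
        (W.subtype ∘ₗ q) ∘ₗ rightSlice φ := by
      ext a b
      simp
    exact (DFunLike.congr_fun this x).trans (hq' _ (hW φ))
  refine ⟨TensorProduct.map p q x, ?_⟩
  have h3 : TensorProduct.map V.subtype W.subtype ∘ₗ TensorProduct.map p q =
      TensorProduct.map (V.subtype ∘ₗ p) LinearMap.id ∘ₗ
        TensorProduct.map LinearMap.id (W.subtype ∘ₗ q) := by
    ext a b
    simp
  rw [← LinearMap.comp_apply, h3, LinearMap.comp_apply, h2, h1]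

end SliceCriterion

section SliceSeparable

variable {k A B : Type u} [Field k] [CommRing A] [Algebra k A] [CommRing B] [Algebra k B]

theorem isSeparableRoot_rightSlice {x : A ⊗[k] B} (hx : IsSeparableRoot k x) (φ : A →ₗ[k] k) :
    IsSeparableRoot k (rightSlice φ x) :=
  isSeparableRoot_leftSlice (hx.map (Algebra.TensorProduct.comm k A B).toAlgHom) φ

end SliceSeparable

/-! ### Slices of the comultiplication and finite dimensional subcoalgebras. -/

section Coalgebra

variable {k A : Type u} [Field k] [AddCommGroup A] [Module k A] [Coalgebra k A]

open Coalgebra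

/-- By coassociativity, slicing twice is slicing once along the convolution of the two forms, so the
slices of one element are stable under further slicing. -/
theorem rightSlice_comul_rightSlice_comul (φ φ' : A →ₗ[k] k) (a : A) :
    rightSlice φ' (comul (R := k) (rightSlice φ (comul (R := k) a))) =
      rightSlice (LinearMap.mul' k k ∘ₗ TensorProduct.map φ φ' ∘ₗ comul) (comul (R := k) a) := by
  have h1 : comul ∘ₗ rightSlice φ = rightSlice φ ∘ₗ (comul (R := k) (A := A)).lTensor A := by
    ext x y
    simp
  have h2 : rightSlice φ' ∘ₗ rightSlice φ ∘ₗ (TensorProduct.assoc k A A A).toLinearMap =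
      rightSlice (LinearMap.mul' k k ∘ₗ TensorProduct.map φ φ') := by
    ext x y z
    simp [mul_smul, smul_comm (φ x)]
  have h3 : rightSlice (LinearMap.mul' k k ∘ₗ TensorProduct.map φ φ') ∘ₗ
      (comul (R := k) (A := A)).rTensor A =
      rightSlice (LinearMap.mul' k k ∘ₗ TensorProduct.map φ φ' ∘ₗ comul) := by
    ext x y
    simp
  rw [← h3, LinearMap.comp_apply, ← h2]
  refine (congrArg (rightSlice φ') (DFunLike.congr_fun h1 _)).trans ?_
  simp

theorem leftSlice_comul_leftSlice_comul (φ φ' : A →ₗ[k] k) (a : A) :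
    leftSlice φ' (comul (R := k) (leftSlice φ (comul (R := k) a))) =
      leftSlice (LinearMap.mul' k k ∘ₗ TensorProduct.map φ' φ ∘ₗ comul) (comul (R := k) a) := by
  have h1 : comul ∘ₗ leftSlice φ = leftSlice φ ∘ₗ (comul (R := k) (A := A)).rTensor A := by
    ext x y
    simp
  have h2 : leftSlice φ' ∘ₗ leftSlice φ =
      leftSlice (LinearMap.mul' k k ∘ₗ TensorProduct.map φ' φ) ∘ₗ
        (TensorProduct.assoc k A A A).toLinearMap := by
    ext x y z
    simp [mul_smul, smul_comm (φ z)]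
  have h3 : leftSlice (LinearMap.mul' k k ∘ₗ TensorProduct.map φ' φ) ∘ₗ
      (comul (R := k) (A := A)).lTensor A =
      leftSlice (LinearMap.mul' k k ∘ₗ TensorProduct.map φ' φ ∘ₗ comul) := by
    ext x y
    simp
  rw [← h3, LinearMap.comp_apply, ← coassoc_apply]
  refine (congrArg (leftSlice φ') (DFunLike.congr_fun h1 _)).trans ?_
  exact DFunLike.congr_fun h2 _

theorem leftSlice_comul_rightSlice_comul (φ ψ : A →ₗ[k] k) (a : A) :
    leftSlice ψ (comul (R := k) (rightSlice φ (comul (R := k) a))) =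
      rightSlice φ (comul (R := k) (leftSlice ψ (comul (R := k) a))) := by
  have h1 : comul ∘ₗ leftSlice ψ = leftSlice ψ ∘ₗ (comul (R := k) (A := A)).rTensor A := by
    ext x y
    simp
  have h2 : comul ∘ₗ rightSlice φ = rightSlice φ ∘ₗ (comul (R := k) (A := A)).lTensor A := by
    ext x y
    simp
  have h3 : leftSlice ψ ∘ₗ rightSlice φ ∘ₗ (TensorProduct.assoc k A A A).toLinearMap =
      rightSlice φ ∘ₗ leftSlice ψ := by
    ext x y z
    simp [smul_comm (φ x)]
  refine (congrArg (leftSlice ψ) (DFunLike.congr_fun h2 _)).trans ?_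
  refine Eq.trans ?_ (congrArg (rightSlice φ) (DFunLike.congr_fun h1 _)).symm
  rw [LinearMap.comp_apply, ← coassoc_apply]
  exact DFunLike.congr_fun h3 _

theorem leftSlice_counit_comul (a : A) : leftSlice counit (comul (R := k) a) = a := by
  simp [leftSlice]

theorem rightSlice_counit_comul (a : A) : rightSlice counit (comul (R := k) a) = a := by
  have : rightSlice (counit (R := k) (A := A)) =
      (TensorProduct.lid k A).toLinearMap ∘ₗ (counit (R := k) (A := A)).rTensor A := by
    ext x y
    simp
  simp [this]

theorem exists_finset_rightSlice_mem {A B : Type u} [AddCommGroup A] [Module k A]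
    [AddCommGroup B] [Module k B] (x : A ⊗[k] B) :
    ∃ s : Finset B, ∀ φ, rightSlice φ x ∈ Submodule.span k (s : Set B) := by
  classical
  obtain ⟨s, rfl⟩ := TensorProduct.exists_finset x
  refine ⟨s.image Prod.snd, fun φ ↦ ?_⟩
  rw [map_sum]
  refine Submodule.sum_mem _ fun i hi ↦ ?_
  rw [rightSlice_tmul]
  exact Submodule.smul_mem _ _ (Submodule.subset_span (Finset.mem_image_of_mem _ hi))

/-- Every element of a coalgebra lies in a finite dimensional subcoalgebra, contained in any given
subspace that contains the element and is stable under slices. -/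
theorem exists_finiteDimensional_subcoalgebra (M : Submodule k A)
    (hl : ∀ a ∈ M, ∀ φ, leftSlice φ (comul (R := k) a) ∈ M)
    (hr : ∀ a ∈ M, ∀ φ, rightSlice φ (comul (R := k) a) ∈ M) {a : A} (ha : a ∈ M) :
    ∃ C ≤ M, a ∈ C ∧ C.FG ∧
      ∀ c ∈ C, comul (R := k) c ∈ LinearMap.range (TensorProduct.map C.subtype C.subtype) := by
  classical
  -- The two-sided slices of `a`. Slicing along the counit on both sides returns `a` itself, and
  -- expanding `comul a` into finitely many tensors bounds the span.
  let C : Submodule k A := Submodule.span k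
    {x | ∃ φ ψ : A →ₗ[k] k, rightSlice φ (comul (R := k) (leftSlice ψ (comul (R := k) a))) = x}
  refine ⟨C, ?_, ?_, ?_, fun c hc ↦ mem_range_map_of_slices (fun ψ ↦ ?_) (fun φ ↦ ?_)⟩
  · refine Submodule.span_le.mpr ?_
    rintro _ ⟨φ, ψ, rfl⟩
    exact hr _ (hl _ ha ψ) φ
  · refine Submodule.subset_span ⟨counit, counit, ?_⟩
    rw [leftSlice_counit_comul, rightSlice_counit_comul]
  · obtain ⟨s, hs⟩ := TensorProduct.exists_finset (comul (R := k) a)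
    choose t ht using fun x : A ↦ exists_finset_rightSlice_mem (comul (R := k) x)
    refine Submodule.FG.of_le (Submodule.fg_span (Finset.finite_toSet (s.biUnion fun i ↦ t i.1)))
      (Submodule.span_le.mpr ?_)
    rintro _ ⟨φ, ψ, rfl⟩
    rw [hs, map_sum, map_sum, map_sum]
    refine Submodule.sum_mem _ fun i hi ↦ ?_
    rw [leftSlice_tmul, map_smul, map_smul]
    refine Submodule.smul_mem _ _ (Submodule.span_mono ?_ (ht i.1 φ))
    exact Finset.coe_subset.mpr (Finset.subset_biUnion_of_mem (fun i : A × A ↦ t i.1) hi)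
  · have : C ≤ C.comap (leftSlice ψ ∘ₗ comul) := by
      refine Submodule.span_le.mpr ?_
      rintro _ ⟨φ, ψ', rfl⟩
      refine Submodule.subset_span
        ⟨φ, LinearMap.mul' k k ∘ₗ TensorProduct.map ψ ψ' ∘ₗ comul, ?_⟩
      rw [LinearMap.comp_apply, leftSlice_comul_rightSlice_comul,
        leftSlice_comul_leftSlice_comul]
    exact this hc
  · have : C ≤ C.comap (rightSlice φ ∘ₗ comul) := by
      refine Submodule.span_le.mpr ?_
      rintro _ ⟨φ', ψ, rfl⟩
      refine Submodule.subset_span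
        ⟨LinearMap.mul' k k ∘ₗ TensorProduct.map φ' φ ∘ₗ comul, ψ, ?_⟩
      rw [LinearMap.comp_apply, rightSlice_comul_rightSlice_comul]
    exact this hc

end Coalgebra

/-! ### Étale Hopf subalgebras exhaust the separable part. -/

section Hopf

variable {k A : Type u} [Field k] [CommRing A] [HopfAlgebra k A]

/-- In the convolution group of algebra endomorphisms of `A`, the antipode is the inverse of the
identity. -/
theorem antipode_antipode_apply (a : A) :
    HopfAlgebra.antipode k (HopfAlgebra.antipode k a) = a :=
  DFunLike.congr_fun (congrArg WithConv.ofConv (inv_inv (WithConv.toConv (AlgHom.id k A)))) a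

/-- The antipode is an anti-homomorphism of coalgebras. -/
theorem comul_antipode_apply (a : A) :
    Bialgebra.comulAlgHom k A (HopfAlgebra.antipode k a) =
      Algebra.TensorProduct.map (HopfAlgebra.antipodeAlgHom k A) (HopfAlgebra.antipodeAlgHom k A)
        (Algebra.TensorProduct.comm k A A (Bialgebra.comulAlgHom k A a)) := by
  let i₁ : WithConv (A →ₐ[k] A ⊗[k] A) := WithConv.toConv Algebra.TensorProduct.includeLeft
  let i₂ : WithConv (A →ₐ[k] A ⊗[k] A) := WithConv.toConv Algebra.TensorProduct.includeRight
  -- In the convolution group of algebra maps `A → A ⊗ A` the comultiplication is `i₁ * i₂`.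
  -- Inversion is composition with the antipode and reverses products, which produces the swap of
  -- factors.
  have h1 : WithConv.toConv (Bialgebra.comulAlgHom k A) = i₁ * i₂ := by
    have : (Algebra.TensorProduct.lmul' k (S := A ⊗[k] A)).comp
        (Algebra.TensorProduct.map i₁.ofConv i₂.ofConv) = .id k _ := by
      ext <;> simp [i₁, i₂]
    refine WithConv.ext ?_
    ext a
    exact (DFunLike.congr_fun this _).symm
  have h2 : (Algebra.TensorProduct.lmul' k (S := A ⊗[k] A)).comp
      (Algebra.TensorProduct.map (i₂⁻¹).ofConv (i₁⁻¹).ofConv) =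
      (Algebra.TensorProduct.map (HopfAlgebra.antipodeAlgHom k A)
        (HopfAlgebra.antipodeAlgHom k A)).comp (Algebra.TensorProduct.comm k A A).toAlgHom := by
    ext x
    · change (1 ⊗ₜ[k] HopfAlgebra.antipode k x) * ((HopfAlgebra.antipode k (1 : A)) ⊗ₜ[k] 1) =
        HopfAlgebra.antipode k (1 : A) ⊗ₜ[k] HopfAlgebra.antipode k x
      simp
    · change (1 ⊗ₜ[k] HopfAlgebra.antipode k (1 : A)) * ((HopfAlgebra.antipode k x) ⊗ₜ[k] 1) =
        HopfAlgebra.antipode k x ⊗ₜ[k] HopfAlgebra.antipode k (1 : A)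
      simp
  have h3 := (congrArg Inv.inv h1).trans (mul_inv_rev i₁ i₂)
  exact (DFunLike.congr_fun (congrArg WithConv.ofConv h3) a).trans
    (DFunLike.congr_fun h2 (Bialgebra.comulAlgHom k A a))

theorem mem_range_map_val_of_le {C : Submodule k A} {S : Subalgebra k A}
    (h : C ≤ Subalgebra.toSubmodule S) {x : A ⊗[k] A}
    (hx : x ∈ LinearMap.range (TensorProduct.map C.subtype C.subtype)) :
    x ∈ (Algebra.TensorProduct.map S.val S.val).range := by
  obtain ⟨z, rfl⟩ := hx
  refine ⟨TensorProduct.map (Submodule.inclusion h) (Submodule.inclusion h) z, ?_⟩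
  have : (Algebra.TensorProduct.map S.val S.val).toLinearMap ∘ₗ
      TensorProduct.map (Submodule.inclusion h) (Submodule.inclusion h) =
      TensorProduct.map C.subtype C.subtype := by
    ext x y
    rfl
  exact DFunLike.congr_fun this z

/-- A subcoalgebra and its image under the antipode generate a Hopf subalgebra. -/
theorem isHopfSubalgebra_adjoin {C : Submodule k A} (hC : ∀ c ∈ C, Coalgebra.comul (R := k) c ∈
      LinearMap.range (TensorProduct.map C.subtype C.subtype)) :
    IsHopfSubalgebra (Algebra.adjoin k (C ∪ HopfAlgebra.antipodeAlgHom k A '' C : Set A)) := by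
  set T := Algebra.adjoin k (C ∪ HopfAlgebra.antipodeAlgHom k A '' C : Set A)
  have hCT : C ≤ Subalgebra.toSubmodule T := fun c hc ↦ Algebra.subset_adjoin (Or.inl hc)
  have hS : T ≤ T.comap (HopfAlgebra.antipodeAlgHom k A) := by
    refine Algebra.adjoin_le ?_
    rintro _ (hc | ⟨c, hc, rfl⟩)
    · exact Algebra.subset_adjoin (Or.inr ⟨_, hc, rfl⟩)
    · refine Algebra.subset_adjoin (Or.inl ?_)
      exact (antipode_antipode_apply (k := k) c).symm ▸ hc
  refine ⟨?_, fun a ha ↦ hS ha⟩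
  suffices h : T ≤ (Algebra.TensorProduct.map T.val T.val).range.comap
    (Bialgebra.comulAlgHom k A) from h
  refine Algebra.adjoin_le ?_
  rintro _ (hc | ⟨c, hc, rfl⟩)
  · exact mem_range_map_val_of_le hCT (hC _ hc)
  · obtain ⟨z, hz⟩ := mem_range_map_val_of_le hCT (hC _ hc)
    let g : T →ₐ[k] T := ((HopfAlgebra.antipodeAlgHom k A).comp T.val).codRestrict T
      fun t ↦ hS t.2
    refine ⟨Algebra.TensorProduct.map g g (Algebra.TensorProduct.comm k T T z), ?_⟩
    have e : ((Algebra.TensorProduct.map T.val T.val).comp (Algebra.TensorProduct.map g g)).comp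
        (Algebra.TensorProduct.comm k T T).toAlgHom =
        ((Algebra.TensorProduct.map (HopfAlgebra.antipodeAlgHom k A)
          (HopfAlgebra.antipodeAlgHom k A)).comp (Algebra.TensorProduct.comm k A A).toAlgHom).comp
          (Algebra.TensorProduct.map T.val T.val) := by
      ext <;> rfl
    refine (DFunLike.congr_fun e z).trans ?_
    refine Eq.trans ?_ (comul_antipode_apply (k := k) c).symm
    exact congrArg (fun w ↦ Algebra.TensorProduct.map (HopfAlgebra.antipodeAlgHom k A)
      (HopfAlgebra.antipodeAlgHom k A) (Algebra.TensorProduct.comm k A A w)) hz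

/-- The maximal pro-étale quotient is the group of connected components. -/
theorem etaleHopfPart_eq_separablePart : etaleHopfPart k A = separablePart k A := by
  classical
  refine le_antisymm (sSup_le_sSup fun S hS ↦ hS.2) fun a ha ↦ ?_
  have hsep : ∀ {c}, c ∈ separablePart k A → IsSeparableRoot k (Bialgebra.comulAlgHom k A c) :=
    fun hc ↦ (mem_separablePart_iff.mp hc).map _
  obtain ⟨C, hCR, haC, ⟨s, rfl⟩, hC⟩ := exists_finiteDimensional_subcoalgebra
    (Subalgebra.toSubmodule (separablePart k A))
    (fun c hc φ ↦ mem_separablePart_iff.mpr (isSeparableRoot_leftSlice (hsep hc) φ))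
    (fun c hc φ ↦ mem_separablePart_iff.mpr (isSeparableRoot_rightSlice (hsep hc) φ)) ha
  have hs : ∀ y ∈ s, IsSeparableRoot k y :=
    fun y hy ↦ mem_separablePart_iff.mp (hCR (Submodule.subset_span hy))
  have hHopf := isHopfSubalgebra_adjoin hC
  set T := Algebra.adjoin k ((Submodule.span k (s : Set A) : Set A) ∪
    HopfAlgebra.antipodeAlgHom k A '' Submodule.span k (s : Set A)) with hTdef
  -- `T` is generated by a finite set of separable elements, so it is étale.
  have hT : T = Algebra.adjoin k ((s ∪ s.image (HopfAlgebra.antipodeAlgHom k A) : Finset A)) := by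
    rw [Finset.coe_union, Finset.coe_image, Algebra.adjoin_union, ← AlgHom.map_adjoin, hTdef,
      Algebra.adjoin_union, ← AlgHom.map_adjoin, Algebra.adjoin_span]
  have het : Algebra.Etale k T := by
    rw [hT]
    refine etale_adjoin_finset _ fun y hy ↦ ?_
    rcases Finset.mem_union.mp hy with hy | hy
    · exact hs y hy
    · obtain ⟨z, hz, rfl⟩ := Finset.mem_image.mp hy
      exact (hs z hz).map _
  exact (show T ≤ etaleHopfPart k A from le_sSup ⟨hHopf, het⟩)
    (Algebra.subset_adjoin (Or.inl haC))

end Hopf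

/-! ### Connectedness, idempotents and constant functions. -/

section Connected

variable {k A : Type u} [Field k] [CommRing A]

theorem isSeparableRoot_of_isIdempotentElem [Algebra k A] {e : A} (he : IsIdempotentElem e) :
    IsSeparableRoot k e := by
  open Polynomial in
  refine ⟨X * (X - 1), ?_, by simp [mul_sub, he.eq]⟩
  -- The Bézout identity `-4 (X² - X) + (2X - 1)² = 1` holds in every characteristic.
  exact ⟨-4, 2 * X - 1, by simp; ring⟩

theorem connectedSpace_primeSpectrum_iff [Nontrivial A] :
    ConnectedSpace (PrimeSpectrum A) ↔ ∀ e : A, IsIdempotentElem e → e = 0 ∨ e = 1 := by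
  refine ⟨fun _ e he ↦ ?_, fun h ↦ ?_⟩
  · have hc : IsClopen (PrimeSpectrum.basicOpen e : Set (PrimeSpectrum A)) :=
      PrimeSpectrum.isClopen_basicOpen_of_mul_add e (1 - e) (by rw [mul_sub, he.eq]; simp)
        (by ring)
    rcases isClopen_iff.mp hc with h0 | h1
    · refine Or.inl (PrimeSpectrum.basicOpen_injOn_isIdempotentElem he IsIdempotentElem.zero ?_)
      rw [PrimeSpectrum.basicOpen_zero]
      exact SetLike.coe_injective h0
    · refine Or.inr (PrimeSpectrum.basicOpen_injOn_isIdempotentElem he IsIdempotentElem.one ?_)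
      rw [PrimeSpectrum.basicOpen_one]
      exact SetLike.coe_injective h1
  · have : PreconnectedSpace (PrimeSpectrum A) := by
      refine preconnectedSpace_iff_clopen.mpr fun s hs ↦ ?_
      obtain ⟨e, he, rfl⟩ := PrimeSpectrum.exists_idempotent_basicOpen_eq_of_isClopen hs
      rcases h e he with rfl | rfl
      · left; simp
      · right; simp
    exact ⟨inferInstance⟩

open Polynomial in
/-- On a connected affine scheme with a rational point, the separable functions are constant. -/
theorem eq_algebraMap_of_mem_separablePart [Algebra k A] [ConnectedSpace (PrimeSpectrum A)]
    (ε : A →ₐ[k] k) {y : A} (hy : y ∈ separablePart k A) : y = algebraMap k A (ε y) := by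
  obtain ⟨p, hp, hpy⟩ := mem_separablePart_iff.mp hy
  have : Nontrivial A := ε.toRingHom.domain_nontrivial
  have hroot : p.IsRoot (ε y) := by
    rw [IsRoot, ← coe_aeval_eq_eval, aeval_algHom_apply, hpy, map_zero]
  -- Write `p = (X - ε y) q` with coprime factors `u (X - ε y) + v q = 1`. Then `v(y) q(y)` is
  -- idempotent; it is not 0, since `ε` kills `y - ε y`, so it is 1 and forces `y = ε y`.
  obtain ⟨q, rfl⟩ := dvd_iff_isRoot.mpr hroot
  obtain ⟨u, v, huv⟩ := hp.isCoprime
  have h0 : (y - algebraMap k A (ε y)) * aeval y q = 0 := by simpa using hpy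
  have h1 : aeval y u * (y - algebraMap k A (ε y)) + aeval y v * aeval y q = 1 := by
    simpa using congrArg (aeval y) huv
  have he : IsIdempotentElem (aeval y v * aeval y q) := by
    rw [IsIdempotentElem]
    linear_combination (aeval y v * aeval y q) * h1 - aeval y u * aeval y v * h0
  rcases connectedSpace_primeSpectrum_iff.mp inferInstance _ he with h | h
  · rw [h, add_zero] at h1
    have := congrArg ε h1
    simp at this
  · linear_combination aeval y v * h0 - (y - algebraMap k A (ε y)) * h

end Connected

/-! ### Universal property of `π₀` and amalgamated free products. -/

/-- The factorisation as an algebra map respects the coalgebra structure automatically, because `g ⊗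
g` is injective over a field. -/
theorem exists_bialgHom_comp_eq {k A B C : Type u} [Field k] [CommRing A] [HopfAlgebra k A]
    [CommRing B] [HopfAlgebra k B] [CommRing C] [HopfAlgebra k C]
    (f : B →ₐc[k] A) (g : C →ₐc[k] A) (hg : Function.Injective g)
    (h : (f : B →ₐ[k] A).range ≤ (g : C →ₐ[k] A).range) : ∃ l : B →ₐc[k] C, g.comp l = f := by
  let e := AlgEquiv.ofInjective (g : C →ₐ[k] A) hg
  let l : B →ₐ[k] C := e.symm.toAlgHom.comp ((f : B →ₐ[k] A).codRestrict _ fun b ↦ h ⟨b, rfl⟩)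
  have hl : ∀ b, g (l b) = f b := fun b ↦
    congrArg Subtype.val (e.apply_symm_apply ⟨f b, h ⟨b, rfl⟩⟩)
  have hl' : (g : C →ₐ[k] A).comp l = f := AlgHom.ext hl
  have inj : Function.Injective (Algebra.TensorProduct.map (g : C →ₐ[k] A) (g : C →ₐ[k] A)) :=
    TensorProduct.map_injective_of_flat_flat (g : C →ₐ[k] A).toLinearMap
      (g : C →ₐ[k] A).toLinearMap hg hg
  refine ⟨BialgHom.ofAlgHom l ?_ ?_, BialgHom.ext hl⟩
  · ext b
    have h1 := CoalgHomClass.counit_comp_apply g (l b)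
    have h2 := CoalgHomClass.counit_comp_apply f b
    rw [hl] at h1
    exact h1.symm.trans h2
  · ext b
    apply inj
    have h1 := CoalgHomClass.map_comp_comul_apply g (l b)
    have h2 := CoalgHomClass.map_comp_comul_apply f b
    rw [hl] at h1
    have h3 : (Algebra.TensorProduct.map (g : C →ₐ[k] A) (g : C →ₐ[k] A)).comp
        (Algebra.TensorProduct.map l l) =
        Algebra.TensorProduct.map (f : B →ₐ[k] A) (f : B →ₐ[k] A) := by
      rw [← Algebra.TensorProduct.map_comp, hl']
    exact (DFunLike.congr_fun h3 _).trans (h2.trans h1.symm)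

namespace KGroup

variable {k : Type u} [Field k]

theorem hom_ext {G H : KGroup k} {f g : G ⟶ H} (h : ∀ x, dual f x = dual g x) : f = g :=
  Quiver.Hom.unop_inj (CommHopfAlgCat.hom_ext (BialgHom.ext h))

theorem epi_of_injective {G H : KGroup k} {f : G ⟶ H} (hf : Function.Injective (dual f)) :
    Epi f :=
  ⟨fun _ _ e ↦ hom_ext fun x ↦ hf (DFunLike.congr_fun (congrArg dual e) x)⟩

theorem exists_factor {G E F : KGroup k} (p : G ⟶ E) {q : G ⟶ F}
    (hq : Function.Injective (dual q))
    (h : (dual p : E.coord →ₐ[k] G.coord).range ≤ (dual q : F.coord →ₐ[k] G.coord).range) :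
    ∃ l : F ⟶ E, q ≫ l = p := by
  obtain ⟨l, hl⟩ := exists_bialgHom_comp_eq (dual p) (dual q) hq h
  exact ⟨(CommHopfAlgCat.ofHom l).op, hom_ext fun x ↦ DFunLike.congr_fun hl x⟩

theorem range_comp_le_separablePart {G H E : KGroup k} (f : H ⟶ G) {p : G ⟶ E}
    (hp : (dual p : E.coord →ₐ[k] G.coord).range ≤ separablePart k G.coord) :
    (dual (f ≫ p) : E.coord →ₐ[k] H.coord).range ≤ separablePart k H.coord := by
  rintro _ ⟨x, rfl⟩
  exact mem_separablePart_iff.mpr ((mem_separablePart_iff.mp (hp ⟨x, rfl⟩)).map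
    (dual f : G.coord →ₐ[k] H.coord))

theorem IsPi0.epi {G E : KGroup k} {q : G ⟶ E} (hq : IsPi0 q) : Epi q :=
  epi_of_injective hq.injective

theorem IsPi0.existsUnique_factor {G E F : KGroup k} {q : G ⟶ E} (hq : IsPi0 q) (p : G ⟶ F)
    (hp : (dual p : F.coord →ₐ[k] G.coord).range ≤ separablePart k G.coord) :
    ∃! l : E ⟶ F, q ≫ l = p := by
  obtain ⟨l, hl⟩ := exists_factor p hq.injective (hq.range_eq ▸ hp)
  have := hq.epi
  exact ⟨l, hl, fun l' hl' ↦ (cancel_epi q).mp (hl'.trans hl.symm)⟩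

/-- The functoriality of the group of connected components. -/
theorem IsPi0.existsUnique_map {G H G' H' : KGroup k} {pH : H ⟶ H'} (hH : IsPi0 pH)
    {p : G ⟶ G'} (hp : IsPi0 p) (α : H ⟶ G) : ∃! β : H' ⟶ G', pH ≫ β = α ≫ p :=
  hH.existsUnique_factor _ (range_comp_le_separablePart α hp.range_eq.le)

theorem isPi0_toEt (G : KGroup k) : IsPi0 ((toEt k).app G) where
  injective := Subtype.val_injective
  range_eq := (Subalgebra.range_val _).trans etaleHopfPart_eq_separablePart

instance (G : KGroup k) : Epi ((toEt k).app G) := (isPi0_toEt G).epi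

theorem toEt_naturality {G H : KGroup k} (f : G ⟶ H) :
    (toEt k).app G ≫ (et k).map f = f ≫ (toEt k).app H :=
  ((toEt k).naturality f).symm

/-- Passing to the groups of connected components of an amalgamated free product is the same as
doing so after passing to the groups of connected components of the factors. -/
theorem isIso_of_isPushout {H G₁ G₂ P H' G₁' G₂' Q P' Q' : KGroup k} {α₁ : H ⟶ G₁} {α₂ : H ⟶ G₂}
    {i₁ : G₁ ⟶ P} {i₂ : G₂ ⟶ P} (hP : IsPushout α₁ α₂ i₁ i₂) {pH : H ⟶ H'} {p₁ : G₁ ⟶ G₁'}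
    {p₂ : G₂ ⟶ G₂'} (hpH : IsPi0 pH) (hp₁ : IsPi0 p₁) (hp₂ : IsPi0 p₂) {β₁ : H' ⟶ G₁'}
    {β₂ : H' ⟶ G₂'} (hβ₁ : pH ≫ β₁ = α₁ ≫ p₁) (hβ₂ : pH ≫ β₂ = α₂ ≫ p₂) {j₁ : G₁' ⟶ Q}
    {j₂ : G₂' ⟶ Q} (hQ : IsPushout β₁ β₂ j₁ j₂) {c : P ⟶ Q} (hc₁ : i₁ ≫ c = p₁ ≫ j₁)
    (hc₂ : i₂ ≫ c = p₂ ≫ j₂) {pP : P ⟶ P'} {pQ : Q ⟶ Q'} (hpP : IsPi0 pP) (hpQ : IsPi0 pQ)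
    {e : P' ⟶ Q'} (he : pP ≫ e = c ≫ pQ) : IsIso e := by
  have := hpH.epi
  have := hp₁.epi
  have := hp₂.epi
  have := hpP.epi
  have := hpQ.epi
  obtain ⟨d₁, hd₁, -⟩ := hp₁.existsUnique_map hpP i₁
  obtain ⟨d₂, hd₂, -⟩ := hp₂.existsUnique_map hpP i₂
  have hd : β₁ ≫ d₁ = β₂ ≫ d₂ := by
    rw [← cancel_epi pH, reassoc_of% hβ₁, reassoc_of% hβ₂, hd₁, hd₂, reassoc_of% hP.w]
  let d : Q ⟶ P' := hQ.desc d₁ d₂ hd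
  have hj₁ : j₁ ≫ d = d₁ := hQ.inl_desc _ _ _
  have hj₂ : j₂ ≫ d = d₂ := hQ.inr_desc _ _ _
  have hcd : c ≫ d = pP := hP.hom_ext
    (by rw [reassoc_of% hc₁, hj₁, hd₁]) (by rw [reassoc_of% hc₂, hj₂, hd₂])
  -- Functions on `P'` are separable, since they embed into `k[P]` as separable elements; hence `d`
  -- factors through `Q'`, and the factor `v` is the inverse of `e`.
  obtain ⟨v, hv, -⟩ := hpQ.existsUnique_factor d (by
    rintro _ ⟨x, rfl⟩
    refine mem_separablePart_iff.mpr (IsSeparableRoot.map ?_ (dual d : P'.coord →ₐ[k] Q.coord))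
    exact (mem_separablePart_iff.mp (hpP.range_eq.le ⟨x, rfl⟩)).of_injective
      (dual pP : P'.coord →ₐ[k] P.coord) hpP.injective)
  have hde : d ≫ e = pQ := by
    refine hQ.hom_ext ?_ ?_
    · rw [← cancel_epi p₁, reassoc_of% hj₁, reassoc_of% hd₁, he, reassoc_of% hc₁]
    · rw [← cancel_epi p₂, reassoc_of% hj₂, reassoc_of% hd₂, he, reassoc_of% hc₂]
  refine ⟨v, ?_, ?_⟩
  · rw [← cancel_epi pP, reassoc_of% he, hv, hcd, Category.comp_id]
  · rw [← cancel_epi pQ, reassoc_of% hv, hde, Category.comp_id]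

theorem existsUnique_isPushout_desc {H G₁ G₂ P H' G₁' G₂' Q : KGroup k} {α₁ : H ⟶ G₁}
    {α₂ : H ⟶ G₂} {i₁ : G₁ ⟶ P} {i₂ : G₂ ⟶ P} (hP : IsPushout α₁ α₂ i₁ i₂) {pH : H ⟶ H'}
    {p₁ : G₁ ⟶ G₁'} {p₂ : G₂ ⟶ G₂'} {β₁ : H' ⟶ G₁'} {β₂ : H' ⟶ G₂'}
    (hβ₁ : pH ≫ β₁ = α₁ ≫ p₁) (hβ₂ : pH ≫ β₂ = α₂ ≫ p₂) {j₁ : G₁' ⟶ Q} {j₂ : G₂' ⟶ Q}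
    (hQ : β₁ ≫ j₁ = β₂ ≫ j₂) : ∃! c : P ⟶ Q, i₁ ≫ c = p₁ ≫ j₁ ∧ i₂ ≫ c = p₂ ≫ j₂ := by
  have h : α₁ ≫ p₁ ≫ j₁ = α₂ ≫ p₂ ≫ j₂ := by
    rw [← reassoc_of% hβ₁, ← reassoc_of% hβ₂, hQ]
  exact ⟨hP.desc _ _ h, ⟨hP.inl_desc _ _ _, hP.inr_desc _ _ _⟩, fun c hc ↦
    hP.hom_ext (hc.1.trans (hP.inl_desc _ _ h).symm) (hc.2.trans (hP.inr_desc _ _ h).symm)⟩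

/-- An amalgamated free product only depends on the amalgamated group up to epimorphisms. -/
theorem isPushout_epi_comp_iff {C : Type*} [Category C] {W X Y Z T : C} (q : W ⟶ X) [Epi q]
    {f : X ⟶ Y} {g : X ⟶ Z} {j₁ : Y ⟶ T} {j₂ : Z ⟶ T} :
    IsPushout (q ≫ f) (q ≫ g) j₁ j₂ ↔ IsPushout f g j₁ j₂ := by
  refine ⟨fun h ↦ ⟨⟨(cancel_epi q).mp (by simpa using h.w)⟩, ⟨?_⟩⟩, fun h ↦ ⟨⟨by simp [h.w]⟩, ⟨?_⟩⟩⟩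
  · refine Limits.PushoutCocone.IsColimit.mk _
      (fun s ↦ h.desc s.inl s.inr (by simp [s.condition])) (by simp) (by simp) ?_
    exact fun s m h₁ h₂ ↦ h.hom_ext (by simp [h₁]) (by simp [h₂])
  · refine Limits.PushoutCocone.IsColimit.mk _
      (fun s ↦ h.desc s.inl s.inr ((cancel_epi q).mp (by simpa using s.condition)))
      (by simp) (by simp) ?_
    exact fun s m h₁ h₂ ↦ h.hom_ext (by simp [h₁]) (by simp [h₂])

instance (G : KGroup k) : Nontrivial G.coord :=
  (Bialgebra.counitAlgHom k G.coord).toRingHom.domain_nontrivial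

/-- Amalgamated free products of connected `k`-groups are connected. -/
theorem IsConnected.of_isPushout {H G₁ G₂ P : KGroup k} {α₁ : H ⟶ G₁} {α₂ : H ⟶ G₂}
    {i₁ : G₁ ⟶ P} {i₂ : G₂ ⟶ P} (hP : IsPushout α₁ α₂ i₁ i₂) (h₁ : G₁.IsConnected)
    (h₂ : G₂.IsConnected) : P.IsConnected := by
  let q := (toEt k).app P
  -- `t` is the trivial morphism, so equality with `q` says that all separable functions on `P` are
  -- constant.
  let t : P ⟶ (et k).obj P := (CommHopfAlgCat.ofHom ((Bialgebra.unitBialgHom k P.coord).comp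
    (Bialgebra.counitBialgHom k (etaleHopfPart k P.coord)))).op
  have key : ∀ {G : KGroup k} (i : G ⟶ P), G.IsConnected → i ≫ q = i ≫ t := by
    intro G i hG
    refine hom_ext fun x ↦ ?_
    have hx : dual q x ∈ separablePart k P.coord := etaleHopfPart_eq_separablePart.le x.2
    have : ConnectedSpace (PrimeSpectrum G.coord) := hG
    have h := eq_algebraMap_of_mem_separablePart (Bialgebra.counitAlgHom k G.coord)
      (mem_separablePart_iff.mpr ((mem_separablePart_iff.mp hx).map
        (dual i : P.coord →ₐ[k] G.coord)))
    refine h.trans ?_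
    have h3 : Bialgebra.counitAlgHom k G.coord ((dual i : P.coord →ₐ[k] G.coord) (dual q x)) =
        Bialgebra.counitAlgHom k P.coord (dual q x) :=
      CoalgHomClass.counit_comp_apply (dual i) (dual q x)
    rw [h3]
    exact (AlgHomClass.commutes (dual i) _).symm
  have hqt : q = t := hP.hom_ext (key i₁ h₁) (key i₂ h₂)
  refine connectedSpace_primeSpectrum_iff.mpr fun e he ↦ ?_
  have hmem : e ∈ etaleHopfPart k P.coord := etaleHopfPart_eq_separablePart.ge
    (mem_separablePart_iff.mpr (isSeparableRoot_of_isIdempotentElem he))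
  have h : e = algebraMap k P.coord (Bialgebra.counitAlgHom k P.coord e) :=
    DFunLike.congr_fun (congrArg dual hqt) (⟨e, hmem⟩ : etaleHopfPart k P.coord)
  rcases IsIdempotentElem.iff_eq_zero_or_one.mp
    (he.map (Bialgebra.counitAlgHom k P.coord)) with h0 | h0
  · exact Or.inl (by rw [h, h0, map_zero])
  · exact Or.inr (by rw [h, h0, map_one])

end KGroup

/-! ### The proposition and its corollary. -/

theorem proposition2p8 {k : Type u} [Field k] {H G₁ G₂ P : KGroup k}
    (α₁ : H ⟶ G₁) (α₂ : H ⟶ G₂) (i₁ : G₁ ⟶ P) (i₂ : G₂ ⟶ P)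
    -- `P` is the amalgamated free product of `G₁` and `G₂` over `H`
    (hP : IsPushout α₁ α₂ i₁ i₂) :
    -- the maximal pro-étale quotient is canonically the group of connected components
    (∀ G : KGroup k, KGroup.IsPi0 ((KGroup.toEt k).app G)) ∧
    -- `G₁^et *_H G₂^et = G₁^et *_{H^et} G₂^et`, and if `Q` denotes this `k`-group, then the
    -- canonical morphism `c : P ⟶ Q` induces an isomorphism `P^et ⟶ Q^et`
    (∀ ⦃Q : KGroup k⦄ (j₁ : (KGroup.et k).obj G₁ ⟶ Q) (j₂ : (KGroup.et k).obj G₂ ⟶ Q),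
      (IsPushout (α₁ ≫ (KGroup.toEt k).app G₁) (α₂ ≫ (KGroup.toEt k).app G₂) j₁ j₂ ↔
        IsPushout ((KGroup.et k).map α₁) ((KGroup.et k).map α₂) j₁ j₂) ∧
      (IsPushout ((KGroup.et k).map α₁) ((KGroup.et k).map α₂) j₁ j₂ →
        (∃! c : P ⟶ Q,
          i₁ ≫ c = (KGroup.toEt k).app G₁ ≫ j₁ ∧ i₂ ≫ c = (KGroup.toEt k).app G₂ ≫ j₂) ∧
        ∀ c : P ⟶ Q,
          i₁ ≫ c = (KGroup.toEt k).app G₁ ≫ j₁ → i₂ ≫ c = (KGroup.toEt k).app G₂ ≫ j₂ →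
          IsIso ((KGroup.et k).map c))) ∧
    -- the same in terms of groups of connected components: for all `p_H : H ⟶ π₀(H)`,
    -- `p₁ : G₁ ⟶ π₀(G₁)`, `p₂ : G₂ ⟶ π₀(G₂)` there are unique induced `βᵢ : π₀(H) ⟶ π₀(Gᵢ)`, and
    -- if `Q` is the amalgamated free product of `π₀(G₁)` and `π₀(G₂)` over `π₀(H)`, then the
    -- canonical `c : P ⟶ Q` induces an isomorphism `π₀(P) ⟶ π₀(Q)`
    (∀ ⦃H' G₁' G₂' : KGroup k⦄ (pH : H ⟶ H') (p₁ : G₁ ⟶ G₁') (p₂ : G₂ ⟶ G₂'),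
      KGroup.IsPi0 pH → KGroup.IsPi0 p₁ → KGroup.IsPi0 p₂ →
      (∃! β₁ : H' ⟶ G₁', pH ≫ β₁ = α₁ ≫ p₁) ∧ (∃! β₂ : H' ⟶ G₂', pH ≫ β₂ = α₂ ≫ p₂) ∧
      ∀ (β₁ : H' ⟶ G₁') (β₂ : H' ⟶ G₂'), pH ≫ β₁ = α₁ ≫ p₁ → pH ≫ β₂ = α₂ ≫ p₂ →
      ∀ ⦃Q : KGroup k⦄ (j₁ : G₁' ⟶ Q) (j₂ : G₂' ⟶ Q), IsPushout β₁ β₂ j₁ j₂ →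
      (∃! c : P ⟶ Q, i₁ ≫ c = p₁ ≫ j₁ ∧ i₂ ≫ c = p₂ ≫ j₂) ∧
      ∀ c : P ⟶ Q, i₁ ≫ c = p₁ ≫ j₁ → i₂ ≫ c = p₂ ≫ j₂ →
      ∀ ⦃P' Q' : KGroup k⦄ (pP : P ⟶ P') (pQ : Q ⟶ Q'), KGroup.IsPi0 pP → KGroup.IsPi0 pQ →
      (∃! e : P' ⟶ Q', pP ≫ e = c ≫ pQ) ∧ ∀ e : P' ⟶ Q', pP ≫ e = c ≫ pQ → IsIso e) ∧
    -- amalgamated free products of connected `k`-groups are connected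
    (G₁.IsConnected → G₂.IsConnected → P.IsConnected) := by
  have nat₁ := KGroup.toEt_naturality α₁
  have nat₂ := KGroup.toEt_naturality α₂
  refine ⟨KGroup.isPi0_toEt, fun Q j₁ j₂ ↦ ⟨?_, fun hQ ↦ ⟨?_, fun c hc₁ hc₂ ↦ ?_⟩⟩,
    fun H' G₁' G₂' pH p₁ p₂ hpH hp₁ hp₂ ↦ ⟨hpH.existsUnique_map hp₁ α₁,
      hpH.existsUnique_map hp₂ α₂, fun β₁ β₂ hβ₁ hβ₂ Q j₁ j₂ hQ ↦
      ⟨KGroup.existsUnique_isPushout_desc hP hβ₁ hβ₂ hQ.w,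
        fun c hc₁ hc₂ P' Q' pP pQ hpP hpQ ↦ ⟨hpP.existsUnique_map hpQ c, fun e he ↦
          KGroup.isIso_of_isPushout hP hpH hp₁ hp₂ hβ₁ hβ₂ hQ hc₁ hc₂ hpP hpQ he⟩⟩⟩,
    KGroup.IsConnected.of_isPushout hP⟩
  -- By naturality both legs factor through the epimorphism `H ⟶ H^et`, which can be dropped from
  -- the pushout.
  · rw [← nat₁, ← nat₂]
    exact KGroup.isPushout_epi_comp_iff _
  · exact KGroup.existsUnique_isPushout_desc hP nat₁ nat₂ hQ.w
  · exact KGroup.isIso_of_isPushout hP (KGroup.isPi0_toEt H) (KGroup.isPi0_toEt G₁)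
      (KGroup.isPi0_toEt G₂) nat₁ nat₂ hQ hc₁ hc₂ (KGroup.isPi0_toEt P) (KGroup.isPi0_toEt Q)
      (KGroup.toEt_naturality c)
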